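/- Let $n\ge 2$ and let $D_n$ be the dihedral group of order $2n$. The generating graph $\Gamma(D_n)$ is the simple graph whose vertices are the elements of $D_n$, two distinct elements $a,b$ being adjacent if and only if $\langle a,b\rangle=D_n$. Let $\Delta(D_n)$ be the graph obtained from $\Gamma(D_n)$ by removing its isolated vertices. Let $\varphi$ be Euler's totient function, $\mu$ the Möbius function, and $n_0$ the product of the distinct primes dividing $n$. Then $\Delta(D_n)$ is connected, and its distance spectrum, that is, the multiset of eigenvalues of the real matrix whose $(u,v)$ entry is the length of a shortest path from $u$ to $v$ in $\Delta(D_n)$, consists of - $-2$ with multiplicity $\varphi(n)+n-n_0-1$; - $-2-\mu(d)\dfrac{\varphi(n)}{\varphi(d)}$ with multiplicity $\varphi(d)$, for each divisor $d>1$ of $n_0$; - the two numbers $$\lambda_{1,2}=\left(n-2+\frac{\varphi(n)}{2}\right)\pm\sqrt{n^2+\left(\frac{3\varphi(n)}{2}\right)^2-2n\varphi(n)},$$ each with multiplicity $1$. Multiplicities of entries of this list that have the same value are added. -/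

import Mathlib

/-- The generating graph of a group `G`: the vertices are the elements of `G`, and two distinct
elements are adjacent if and only if together they generate `G`. -/
def generatingGraph (G : Type*) [Group G] : SimpleGraph G where
  Adj a b := a ≠ b ∧ Subgroup.closure {a, b} = ⊤
  symm := ⟨fun a b h => ⟨h.1.symm, by rw [Set.pair_comm]; exact h.2⟩⟩
  loopless := ⟨fun _ h => h.1 rfl⟩

/-- The generating graph of `G` after removing the isolated vertices. -/
abbrev reducedGeneratingGraph (G : Type*) [Group G] :
    SimpleGraph {g : G | ¬ (generatingGraph G).IsIsolated g} :=
  (generatingGraph G).induce {g : G | ¬ (generatingGraph G).IsIsolated g}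

/-- The distance matrix of a graph: the `(u, v)` entry is the length of a shortest path
between `u` and `v`. -/
noncomputable def distanceMatrix {V : Type*} (X : SimpleGraph V) : Matrix V V ℝ :=
  Matrix.of fun u v => (X.dist u v : ℝ)

open Classical in
/-- The distance spectrum of a finite graph: the eigenvalues of its distance matrix, with
multiplicity. -/
noncomputable def distanceSpectrum {V : Type*} [Finite V] (X : SimpleGraph V) : Multiset ℝ :=
  letI := Fintype.ofFinite V
  (distanceMatrix X).charpoly.roots

/-! A rotation `r i` is non-isolated exactly when `i` is a unit of `ZMod n`; every reflection is
non-isolated. The unit rotations form a coclique, each joined to every reflection, and `sr i`, `sr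
j` are adjacent exactly when `i - j` is a unit. So the graph is the join of a coclique on φ(n)
points with the unitary Cayley graph of ℤ/n, and distances are at most 2. With K the adjacency
matrix of the latter, the distance matrix plus 2I is a rank-two matrix, built from all-ones blocks,
minus diag(0, K).

The characters of ℤ/n diagonalise K: a character of order d has as eigenvalue the Ramanujan sum
μ(d)φ(n)/φ(d) (`sum_units_addChar`), and there are φ(d) of them. The rank-two part affects only the
span of the two block indicators, where it yields a quadratic; the matrix determinant lemma makes
this precise (`Matrix.eval_charpoly_join`). Non-squarefree d have μ(d) = 0, so their n - n₀
characters join the φ(n) - 1 sum-zero directions on the coclique in the eigenvalue -2. -/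

open Polynomial

/-! ### Ramanujan sums and characters of ℤ/n -/

/-- Averaging over a surjective homomorphism of finite groups. -/
theorem card_mul_sum_comp_of_surjective {G H R : Type*} [Group G] [Group H] [Fintype G] [Fintype H]
    [CommSemiring R] (f : G →* H) (hf : Function.Surjective f) (g : H → R) :
    (Fintype.card H : R) * ∑ u, g (f u) = (Fintype.card G : R) * ∑ v, g v := by
  have h1 : ∀ v : H, ∑ u, g (v * f u) = ∑ u, g (f u) := by
    intro v
    obtain ⟨w, rfl⟩ := hf v
    simp_rw [← map_mul]
    exact Equiv.sum_comp (Equiv.mulLeft w) (fun u => g (f u))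
  have h2 : ∀ u : G, ∑ v, g (v * f u) = ∑ v, g v := fun u =>
    Equiv.sum_comp (Equiv.mulRight (f u)) g
  have h3 := Finset.sum_comm (s := (Finset.univ : Finset H)) (t := (Finset.univ : Finset G))
    (f := fun v u => g (v * f u))
  simpa [h1, h2] using h3

/-- The sum of all complex `d`-th roots of unity. -/
theorem sum_nthRootsFinset_one (d : ℕ) (hd : 0 < d) :
    ∑ z ∈ nthRootsFinset d (1 : ℂ), z = if d = 1 then 1 else 0 := by
  have hζ := Complex.isPrimitiveRoot_exp d hd.ne'
  have h1 : ∑ z ∈ nthRootsFinset d (1 : ℂ), z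
      = ∑ i ∈ Finset.range d, Complex.exp (2 * Real.pi * Complex.I / d) ^ i := by
    classical
    have : (nthRootsFinset d (1 : ℂ)).val = nthRoots d (1 : ℂ) := by
      rw [nthRootsFinset, Multiset.toFinset_val, Multiset.dedup_eq_self.2 hζ.nthRoots_one_nodup]
    rw [Finset.sum_eq_multiset_sum, this, hζ.nthRoots_eq (one_pow d)]
    simp [Finset.sum_eq_multiset_sum]
  rw [h1]
  split_ifs with h
  · subst h; simp
  · exact hζ.geom_sum_eq_zero (by omega)

/-- The sum of the primitive complex `d`-th roots of unity is `μ d`. -/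
theorem sum_primitiveRoots (d : ℕ) (hd : 0 < d) :
    ∑ z ∈ primitiveRoots d ℂ, z = (ArithmeticFunction.moebius d : ℂ) := by
  classical
  -- Each `m`-th root of unity is primitive of exactly one order dividing `m`; Möbius inversion of
  -- this identity gives the claim.
  have key : ∀ m > 0, ∑ i ∈ m.divisors, ∑ z ∈ primitiveRoots i ℂ, z
      = if m = 1 then (1 : ℂ) else 0 := by
    intro m hm
    rw [← sum_nthRootsFinset_one m hm, IsPrimitiveRoot.nthRoots_one_eq_biUnion_primitiveRoots,
      Finset.sum_biUnion fun i _ j _ hij => IsPrimitiveRoot.disjoint hij]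
  rw [← ArithmeticFunction.sum_eq_iff_sum_mul_moebius_eq.1 key d hd,
    Finset.sum_eq_single (d, 1)]
  · simp
  · rintro ⟨a, b⟩ hab hne
    rw [Nat.mem_divisorsAntidiagonal] at hab
    simp only [mul_ite, mul_one, mul_zero, ite_eq_right_iff]
    rintro rfl
    exact absurd (by simpa using hab.1) (fun h : a = d => hne (by rw [h]))
  · intro h
    simp [Nat.mem_divisorsAntidiagonal, hd.ne'] at h

theorem sum_units_pow_val {d : ℕ} [NeZero d] {ζ : ℂ} (hζ : IsPrimitiveRoot ζ d) :
    ∑ v : (ZMod d)ˣ, ζ ^ (v : ZMod d).val = ∑ z ∈ primitiveRoots d ℂ, z := by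
  refine Finset.sum_bij (fun v _ => ζ ^ (v : ZMod d).val) ?_ ?_ ?_ (fun _ _ => rfl)
  · intro v _
    rw [mem_primitiveRoots (NeZero.pos d)]
    exact hζ.pow_of_coprime _ (ZMod.val_coe_unit_coprime v)
  · intro v _ w _ h
    exact Units.ext (ZMod.val_injective d (hζ.pow_inj (ZMod.val_lt _) (ZMod.val_lt _) h))
  · intro z hz
    rw [mem_primitiveRoots (NeZero.pos d), hζ.isPrimitiveRoot_iff] at hz
    obtain ⟨i, hi, hc, rfl⟩ := hz
    exact ⟨ZMod.unitOfCoprime i hc, Finset.mem_univ _, by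
      simp [ZMod.coe_unitOfCoprime, ZMod.val_natCast, Nat.mod_eq_of_lt hi]⟩

theorem AddChar.apply_eq_pow_val {n : ℕ} [NeZero n] (ψ : AddChar (ZMod n) ℂ) (x : ZMod n) :
    ψ x = ψ 1 ^ x.val := by
  rw [← AddChar.map_nsmul_eq_pow, nsmul_one, ZMod.natCast_zmod_val]

/-- A character of ℤ/n is determined by its value at 1, so the two orders agree. -/
theorem AddChar.isPrimitiveRoot_apply_one {n : ℕ} [NeZero n] (ψ : AddChar (ZMod n) ℂ) :
    IsPrimitiveRoot (ψ 1) (addOrderOf ψ) := by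
  have h : ∀ k : ℕ, ψ 1 ^ k = 1 ↔ k • ψ = 0 := by
    intro k
    rw [← AddChar.nsmul_apply]
    constructor
    · intro h
      ext x
      rw [AddChar.apply_eq_pow_val, h, one_pow, AddChar.zero_apply]
    · intro h
      rw [h, AddChar.zero_apply]
  exact ⟨(h _).2 (addOrderOf_nsmul_eq_zero ψ), fun k hk => addOrderOf_dvd_of_nsmul_eq_zero ((h k).1 hk)⟩

/-- Evaluation of Ramanujan sums. -/
theorem sum_units_addChar {n : ℕ} [NeZero n] (ψ : AddChar (ZMod n) ℂ) :
    ∑ u : (ZMod n)ˣ, ψ u = (ArithmeticFunction.moebius (addOrderOf ψ) : ℂ) *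
      ((Nat.totient n : ℂ) / Nat.totient (addOrderOf ψ)) := by
  have hζ := ψ.isPrimitiveRoot_apply_one
  have hdn : addOrderOf ψ ∣ n := by
    have := addOrderOf_dvd_card (x := ψ)
    rwa [AddChar.card_eq, ZMod.card] at this
  have hd : 0 < addOrderOf ψ := Nat.pos_of_dvd_of_pos hdn (NeZero.pos n)
  generalize addOrderOf ψ = d at *
  have : NeZero d := ⟨hd.ne'⟩
  -- `ψ u` depends only on `u` mod `d`, so the sum descends along the surjection (ℤ/n)ˣ → (ℤ/d)ˣ.
  have key := card_mul_sum_comp_of_surjective (ZMod.unitsMap hdn) (ZMod.unitsMap_surjective hdn)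
    (fun v => ψ 1 ^ (v : ZMod d).val)
  have h2 : ∀ u : (ZMod n)ˣ, ψ 1 ^ (ZMod.unitsMap hdn u : ZMod d).val = ψ u := by
    intro u
    rw [ψ.apply_eq_pow_val u, ZMod.unitsMap_val, ZMod.cast_eq_val, ZMod.val_natCast,
      ← pow_mod_orderOf (ψ 1) (ZMod.val (u : ZMod n)), ← hζ.eq_orderOf]
  simp only [h2, ZMod.card_units_eq_totient] at key
  rw [sum_units_pow_val hζ, sum_primitiveRoots d hd] at key
  have h0 : (Nat.totient d : ℂ) ≠ 0 := by exact_mod_cast (Nat.totient_pos.2 hd).ne'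
  field_simp
  linear_combination key

/-- The dual of ℤ/n is cyclic of order `n`; this is the source of the multiplicities φ(d). -/
theorem prod_addChar_addOrderOf {n : ℕ} [NeZero n] {M : Type*} [CommMonoid M] (F : ℕ → M) :
    ∏ ψ : AddChar (ZMod n) ℂ, F (addOrderOf ψ) = ∏ d ∈ n.divisors, F d ^ Nat.totient d := by
  classical
  have : IsAddCyclic (AddChar (ZMod n) ℂ) :=
    isAddCyclic_of_surjective (AddChar.zmodAddEquiv (n := n)) (AddEquiv.surjective _)
  have hc : Fintype.card (AddChar (ZMod n) ℂ) = n := by rw [AddChar.card_eq, ZMod.card]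
  rw [← Finset.prod_fiberwise_of_maps_to (t := n.divisors) (g := fun ψ => addOrderOf ψ)]
  · refine Finset.prod_congr rfl fun d hd => ?_
    rw [Finset.prod_congr rfl (g := fun _ => F d) (fun ψ hψ => by rw [(Finset.mem_filter.1 hψ).2]),
      Finset.prod_const, IsAddCyclic.card_addOrderOf_eq_totient
        (by rw [hc]; exact Nat.dvd_of_mem_divisors hd)]
  · intro ψ _
    rw [Nat.mem_divisors]
    exact ⟨by simpa only [hc] using addOrderOf_dvd_card (x := ψ), NeZero.ne n⟩

/-! ### Spectrum of the unitary Cayley graph -/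

open Classical in
/-- The adjacency matrix of the unitary Cayley graph of `ℤ/n`. -/
noncomputable def unitaryCayleyMatrix (n : ℕ) (R : Type*) [Zero R] [One R] :
    Matrix (ZMod n) (ZMod n) R :=
  Matrix.of fun i j => if IsUnit (i - j) then 1 else 0

theorem sum_ite_isUnit {M R : Type*} [Monoid M] [Fintype M] [Fintype Mˣ]
    [DecidablePred (IsUnit : M → Prop)] [AddCommMonoid R] (f : M → R) :
    ∑ x, (if IsUnit x then f x else 0) = ∑ u : Mˣ, f u := by
  rw [← Finset.sum_filter]
  symm
  refine Finset.sum_bij (fun u _ => (u : M)) ?_ ?_ ?_ (fun _ _ => rfl)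
  · intro u _; simp
  · intro u _ v _ h; exact Units.ext h
  · intro x hx
    obtain ⟨u, rfl⟩ := (Finset.mem_filter.1 hx).2
    exact ⟨u, Finset.mem_univ _, rfl⟩

theorem unitaryCayleyMatrix_mulVec_addChar {n : ℕ} [NeZero n] (ψ : AddChar (ZMod n) ℂ) :
    (unitaryCayleyMatrix n ℂ).mulVec ψ = (∑ u : (ZMod n)ˣ, ψ u) • (ψ : ZMod n → ℂ) := by
  classical
  ext i
  have h : ∀ x : ZMod n, IsUnit (i - x) ↔ IsUnit (x - i) := fun x => by
    rw [← neg_sub, IsUnit.neg_iff]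
  rw [Matrix.mulVec, dotProduct, ← Equiv.sum_comp (Equiv.addRight i)]
  simp only [unitaryCayleyMatrix, Matrix.of_apply, Equiv.coe_addRight, h, add_sub_cancel_right,
    ite_mul, one_mul, zero_mul, AddChar.map_add_eq_mul, Pi.smul_apply, smul_eq_mul]
  rw [sum_ite_isUnit (fun x => ψ x * ψ i), Finset.sum_mul]

theorem charpoly_unitaryCayleyMatrix_complex (n : ℕ) [NeZero n] :
    (unitaryCayleyMatrix n ℂ).charpoly =
      ∏ ψ : AddChar (ZMod n) ℂ, (X - C (∑ u : (ZMod n)ˣ, ψ u)) := by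
  classical
  rw [← Matrix.charpoly_diagonal, ← Matrix.charpoly_mulVecLin,
    ← LinearMap.charpoly_toMatrix _ (AddChar.complexBasis (ZMod n))]
  congr 1
  ext χ ψ
  rw [LinearMap.toMatrix_apply, Matrix.mulVecLin_apply, AddChar.complexBasis_apply,
    unitaryCayleyMatrix_mulVec_addChar, ← AddChar.complexBasis_apply, map_smul,
    Module.Basis.repr_self]
  by_cases h : χ = ψ
  · subst h; simp
  · simp [h, Finsupp.single_eq_of_ne h]

/-- The spectrum of the unitary Cayley graph of `ℤ/n`. -/
theorem charpoly_unitaryCayleyMatrix (n : ℕ) [NeZero n] :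
    (unitaryCayleyMatrix n ℝ).charpoly =
      ∏ d ∈ n.divisors, (X - C ((ArithmeticFunction.moebius d : ℝ) *
        ((Nat.totient n : ℝ) / (Nat.totient d : ℝ)))) ^ Nat.totient d := by
  apply Polynomial.map_injective Complex.ofRealHom Complex.ofRealHom.injective
  have h : (unitaryCayleyMatrix n ℝ).map Complex.ofRealHom = unitaryCayleyMatrix n ℂ := by
    ext i j
    simp [unitaryCayleyMatrix, apply_ite]
  rw [← Matrix.charpoly_map, h, charpoly_unitaryCayleyMatrix_complex]
  simp_rw [sum_units_addChar]
  rw [prod_addChar_addOrderOf (fun d => X - C ((ArithmeticFunction.moebius d : ℂ) *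
        ((Nat.totient n : ℂ) / (Nat.totient d : ℂ)))), Polynomial.map_prod]
  simp

/-! ### Generating pairs in the dihedral group -/

namespace DihedralGroup
variable {n : ℕ}

/-- The subgroup of `D_n` generated by `sr j` and the rotations by multiples of `i`. -/
def reflectionSubgroup (i j : ZMod n) : Subgroup (DihedralGroup n) where
  carrier := {g | match g with
    | r k => i ∣ k
    | sr k => i ∣ k - j}
  one_mem' := by simp [one_def, -r_zero]
  mul_mem' := by
    rintro (a | a) (b | b) ha hb <;> simp only [Set.mem_ofPred_eq, r_mul_r, r_mul_sr, sr_mul_r,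
      sr_mul_sr] at ha hb ⊢
    · exact dvd_add ha hb
    · convert dvd_sub hb ha using 1; ring
    · convert dvd_add ha hb using 1; ring
    · convert dvd_sub hb ha using 1; ring
  inv_mem' := by
    rintro (a | a) ha <;> simp only [Set.mem_ofPred_eq, inv_r, inv_sr] at ha ⊢
    · exact (dvd_neg).2 ha
    · exact ha

/-- The subgroup of rotations. -/
def rotationSubgroup (n : ℕ) : Subgroup (DihedralGroup n) where
  carrier := {g | ∃ k, g = r k}
  one_mem' := ⟨0, rfl⟩
  mul_mem' := by
    rintro _ _ ⟨a, rfl⟩ ⟨b, rfl⟩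
    exact ⟨_, r_mul_r a b⟩
  inv_mem' := by
    rintro _ ⟨a, rfl⟩
    exact ⟨_, inv_r a⟩

theorem closure_r_r_ne_top (i j : ZMod n) : Subgroup.closure {r i, r j} ≠ ⊤ := by
  intro h
  have h1 : Subgroup.closure {r i, r j} ≤ rotationSubgroup n := by
    rw [Subgroup.closure_le]
    rintro x (rfl | rfl)
    · exact ⟨i, rfl⟩
    · exact ⟨j, rfl⟩
  rw [h] at h1
  obtain ⟨k, hk⟩ := h1 (Subgroup.mem_top (sr 0))
  cases hk

theorem eq_top_of_r_mem_of_sr_mem {H : Subgroup (DihedralGroup n)} {i j : ZMod n} (hi : IsUnit i)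
    (hr : r i ∈ H) (hsr : sr j ∈ H) : H = ⊤ := by
  have hall : ∀ k, r k ∈ H := by
    intro k
    obtain ⟨u, rfl⟩ := hi
    obtain ⟨m, hm⟩ := ZMod.intCast_surjective ((↑u⁻¹ : ZMod n) * k)
    have := H.zpow_mem hr m
    rwa [r_zpow, hm, Units.mul_inv_cancel_left] at this
  rw [eq_top_iff]
  rintro (k | k) -
  · exact hall k
  · have := H.mul_mem hsr (hall (k - j))
    rwa [sr_mul_r, add_sub_cancel] at this

theorem isUnit_of_le_reflectionSubgroup {i j : ZMod n}
    (h : (⊤ : Subgroup (DihedralGroup n)) ≤ reflectionSubgroup i j) : IsUnit i :=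
  isUnit_iff_dvd_one.2 (h (Subgroup.mem_top (r 1)))

theorem closure_r_sr_eq_top_iff (i j : ZMod n) :
    Subgroup.closure {r i, sr j} = ⊤ ↔ IsUnit i := by
  constructor
  · intro h
    apply isUnit_of_le_reflectionSubgroup (j := j)
    rw [← h, Subgroup.closure_le]
    rintro x (rfl | rfl)
    · exact dvd_refl i
    · change i ∣ j - j
      simp
  · intro h
    exact eq_top_of_r_mem_of_sr_mem h (Subgroup.subset_closure (by simp))
      (Subgroup.subset_closure (Set.mem_insert_of_mem _ rfl))

theorem closure_sr_sr_eq_top_iff (i j : ZMod n) :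
    Subgroup.closure {sr i, sr j} = ⊤ ↔ IsUnit (i - j) := by
  constructor
  · intro h
    apply isUnit_of_le_reflectionSubgroup (j := j)
    rw [← h, Subgroup.closure_le]
    rintro x (rfl | rfl)
    · exact dvd_refl (i - j)
    · change i - j ∣ j - j
      simp
  · intro h
    have h1 : sr i ∈ Subgroup.closure {sr i, sr j} := Subgroup.subset_closure (by simp)
    have h2 : sr j ∈ Subgroup.closure {sr i, sr j} :=
      Subgroup.subset_closure (Set.mem_insert_of_mem _ rfl)
    exact eq_top_of_r_mem_of_sr_mem h (by simpa using Subgroup.mul_mem _ h2 h1) h2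

theorem generatingGraph_adj_r_r (i j : ZMod n) : ¬ (generatingGraph _).Adj (r i) (r j) :=
  fun h => closure_r_r_ne_top i j h.2

theorem generatingGraph_adj_r_sr (i j : ZMod n) :
    (generatingGraph _).Adj (r i) (sr j) ↔ IsUnit i := by
  rw [← closure_r_sr_eq_top_iff i j]
  exact ⟨fun h => h.2, fun h => ⟨by simp, h⟩⟩

theorem generatingGraph_adj_sr_sr (hn : 2 ≤ n) (i j : ZMod n) :
    (generatingGraph _).Adj (sr i) (sr j) ↔ IsUnit (i - j) := by
  rw [← closure_sr_sr_eq_top_iff i j]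
  refine ⟨fun h => h.2, fun h => ⟨fun hij => ?_, h⟩⟩
  rw [closure_sr_sr_eq_top_iff] at h
  -- If `i = j`, then `0` would be a unit, impossible for `n ≥ 2`.
  have : Fact (1 < n) := ⟨hn⟩
  cases hij
  simp at h

theorem not_isIsolated_r_iff (i : ZMod n) :
    ¬ (generatingGraph _).IsIsolated (r i) ↔ IsUnit i := by
  constructor
  · intro h
    simp only [SimpleGraph.IsIsolated, not_forall, not_not] at h
    obtain ⟨j | j, hj⟩ := h
    · exact absurd hj (generatingGraph_adj_r_r i j)
    · exact (generatingGraph_adj_r_sr i j).1 hj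
  · exact fun h h0 => h0 (sr 0) ((generatingGraph_adj_r_sr i 0).2 h)

theorem not_isIsolated_sr (i : ZMod n) : ¬ (generatingGraph _).IsIsolated (sr i) :=
  fun h0 => h0 (r 1) ((generatingGraph_adj_r_sr 1 i).2 isUnit_one).symm

/-- The vertices of the reduced generating graph of `D_n`: generators of the rotation subgroup and
reflections. -/
noncomputable def unitsSumEquiv (n : ℕ) :
    (ZMod n)ˣ ⊕ ZMod n ≃ {g : DihedralGroup n | ¬ (generatingGraph _).IsIsolated g} :=
  Equiv.ofBijective
    (Sum.elim (fun u => ⟨r u, (not_isIsolated_r_iff _).2 u.isUnit⟩)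
      (fun i => ⟨sr i, not_isIsolated_sr i⟩)) <| by
    constructor
    · rintro (u | i) (v | j) h <;> simp at h
      · rw [Units.ext h]
      · rw [h]
    · rintro ⟨i | i, hi⟩
      · exact ⟨.inl ((not_isIsolated_r_iff i).1 hi).unit, by simp⟩
      · exact ⟨.inr i, rfl⟩

theorem adj_unitsSumEquiv_inl_inl (u v : (ZMod n)ˣ) :
    ¬ (reducedGeneratingGraph (DihedralGroup n)).Adj (unitsSumEquiv n (.inl u))
      (unitsSumEquiv n (.inl v)) :=
  generatingGraph_adj_r_r _ _

theorem adj_unitsSumEquiv_inl_inr (u : (ZMod n)ˣ) (j : ZMod n) :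
    (reducedGeneratingGraph (DihedralGroup n)).Adj (unitsSumEquiv n (.inl u))
      (unitsSumEquiv n (.inr j)) :=
  (generatingGraph_adj_r_sr _ _).2 u.isUnit

theorem adj_unitsSumEquiv_inr_inr (hn : 2 ≤ n) (i j : ZMod n) :
    (reducedGeneratingGraph (DihedralGroup n)).Adj (unitsSumEquiv n (.inr i))
      (unitsSumEquiv n (.inr j)) ↔ IsUnit (i - j) :=
  generatingGraph_adj_sr_sr hn i j

end DihedralGroup

/-! ### Connectedness and distances -/

theorem SimpleGraph.dist_eq_two_of_common_neighbor {V : Type*} {X : SimpleGraph V} {u v w : V}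
    (huv : u ≠ v) (hadj : ¬ X.Adj u v) (hu : X.Adj u w) (hv : X.Adj w v) : X.dist u v = 2 := by
  have h1 : X.dist u v ≤ 2 := SimpleGraph.dist_le (.cons hu (.cons hv .nil))
  have hr : X.Reachable u v := hu.reachable.trans hv.reachable
  have h2 : X.dist u v ≠ 0 := fun h => huv (hr.dist_eq_zero_iff.1 h)
  have h3 : X.dist u v ≠ 1 := fun h => hadj (SimpleGraph.dist_eq_one_iff_adj.1 h)
  omega

namespace DihedralGroup
variable {n : ℕ}

theorem connected_reducedGeneratingGraph (n : ℕ) :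
    (reducedGeneratingGraph (DihedralGroup n)).Connected := by
  rw [SimpleGraph.connected_iff_exists_forall_reachable]
  refine ⟨unitsSumEquiv n (.inr 0), fun w => ?_⟩
  obtain ⟨u | j, rfl⟩ := (unitsSumEquiv n).surjective w
  · exact (adj_unitsSumEquiv_inl_inr u 0).symm.reachable
  · exact (adj_unitsSumEquiv_inl_inr 1 0).symm.reachable.trans
      (adj_unitsSumEquiv_inl_inr 1 j).reachable

open Classical in
theorem dist_unitsSumEquiv_inl_inl (u v : (ZMod n)ˣ) :
    (reducedGeneratingGraph (DihedralGroup n)).dist (unitsSumEquiv n (.inl u))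
      (unitsSumEquiv n (.inl v)) = if u = v then 0 else 2 := by
  split_ifs with h
  · rw [h, SimpleGraph.dist_self]
  · exact SimpleGraph.dist_eq_two_of_common_neighbor (by simpa using h)
      (adj_unitsSumEquiv_inl_inl u v) (adj_unitsSumEquiv_inl_inr u 0)
      (adj_unitsSumEquiv_inl_inr v 0).symm

theorem dist_unitsSumEquiv_inl_inr (u : (ZMod n)ˣ) (j : ZMod n) :
    (reducedGeneratingGraph (DihedralGroup n)).dist (unitsSumEquiv n (.inl u))
      (unitsSumEquiv n (.inr j)) = 1 :=
  SimpleGraph.dist_eq_one_iff_adj.2 (adj_unitsSumEquiv_inl_inr u j)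

open Classical in
theorem dist_unitsSumEquiv_inr_inr (hn : 2 ≤ n) (i j : ZMod n) :
    (reducedGeneratingGraph (DihedralGroup n)).dist (unitsSumEquiv n (.inr i))
      (unitsSumEquiv n (.inr j)) = if i = j then 0 else if IsUnit (i - j) then 1 else 2 := by
  split_ifs with h h'
  · rw [h, SimpleGraph.dist_self]
  · exact SimpleGraph.dist_eq_one_iff_adj.2 ((adj_unitsSumEquiv_inr_inr hn i j).2 h')
  · exact SimpleGraph.dist_eq_two_of_common_neighbor (by simpa using h)
      (mt (adj_unitsSumEquiv_inr_inr hn i j).1 h') (adj_unitsSumEquiv_inl_inr 1 i).symm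
      (adj_unitsSumEquiv_inl_inr 1 j)

end DihedralGroup

/-! ### Determinant of the join -/

namespace Matrix

/-- Determinant of a perturbation `A + P * V` when `A` acts on the columns of `P` through `E`. -/
theorem det_add_mul_of_mul_eq_mul {m k R : Type*} [Fintype m] [DecidableEq m] [Fintype k]
    [DecidableEq k] [CommRing R] {A : Matrix m m R} {E : Matrix k k R} {P : Matrix m k R}
    (V : Matrix k m R) (h : A * P = P * E) (hA : IsUnit A.det) (hE : IsUnit E.det) :
    (A + P * V).det * E.det = A.det * (E + V * P).det := by
  -- This moves the inverse in det(A + PV) = det A · det(1 + V A⁻¹ P) to the small matrix `E`.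
  have h1 : A⁻¹ * P = P * E⁻¹ := by
    calc A⁻¹ * P = A⁻¹ * (P * E * E⁻¹) := by rw [mul_nonsing_inv_cancel_right _ _ hE]
      _ = P * E⁻¹ := by rw [← h, Matrix.mul_assoc A, nonsing_inv_mul_cancel_left _ _ hA]
  rw [det_add_mul P V hA, Matrix.mul_assoc V, h1, mul_assoc, ← det_mul, Matrix.add_mul,
    Matrix.one_mul, Matrix.mul_assoc, Matrix.mul_assoc, nonsing_inv_mul _ hE, Matrix.mul_one]

/-- The all-ones matrix. -/
def allOnes (m k R : Type*) [One R] : Matrix m k R := of fun _ _ => 1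

@[simp]
theorem allOnes_apply {m k R : Type*} [One R] (i : m) (j : k) : allOnes m k R i j = 1 := rfl

theorem allOnes_mul_allOnes (m k l R : Type*) [Fintype k] [CommRing R] :
    allOnes m k R * allOnes k l R = (Fintype.card k : R) • allOnes m l R := by
  ext i j
  simp [Matrix.mul_apply]

/-- Evaluation of the characteristic polynomial of the distance matrix of the join of a coclique
with a regular graph of adjacency matrix `K`. -/
theorem eval_charpoly_join {m k : Type*} [Fintype m] [DecidableEq m] [Fintype k] [DecidableEq k]
    (K : Matrix k k ℝ) (r y : ℝ) (hK : K * allOnes k Unit ℝ = r • allOnes k Unit ℝ)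
    (hy : y ≠ 0) (hyr : y + r ≠ 0) (hdet : (y • 1 + K).det ≠ 0) :
    (scalar (m ⊕ k) (y - 2) - fromBlocks ((2 : ℝ) • allOnes m m ℝ - (2 : ℝ) • 1) (allOnes m k ℝ)
      (allOnes k m ℝ) ((2 : ℝ) • allOnes k k ℝ - (2 : ℝ) • 1 - K)).det * (y * (y + r)) =
    y ^ Fintype.card m * (y • 1 + K).det *
      ((y - 2 * Fintype.card m) * (y + r - 2 * Fintype.card k)
        - Fintype.card m * Fintype.card k) := by
  -- The shift by 2 absorbs the `-2` diagonal. The columns of `P` are the block indicators, `E` is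
  -- the action of `A` on them, and `P * V` carries the all-ones blocks.
  set A : Matrix (m ⊕ k) (m ⊕ k) ℝ := fromBlocks (y • 1) 0 0 (y • 1 + K)
  set P : Matrix (m ⊕ k) (Unit ⊕ Unit) ℝ :=
    fromBlocks (allOnes m Unit ℝ) 0 0 (allOnes k Unit ℝ)
  set V : Matrix (Unit ⊕ Unit) (m ⊕ k) ℝ :=
    fromBlocks ((-2 : ℝ) • allOnes Unit m ℝ) ((-1 : ℝ) • allOnes Unit k ℝ)
      ((-1 : ℝ) • allOnes Unit m ℝ) ((-2 : ℝ) • allOnes Unit k ℝ)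
  set E : Matrix (Unit ⊕ Unit) (Unit ⊕ Unit) ℝ := fromBlocks (y • 1) 0 0 ((y + r) • 1)
  have hAP : A * P = P * E := by
    simp only [A, P, E, fromBlocks_multiply]
    congr 1 <;> simp [Matrix.add_mul, Matrix.mul_add, hK, add_smul]
  have hA : A.det = y ^ Fintype.card m * (y • 1 + K).det := by
    simp [A, det_fromBlocks_zero₂₁]
  have hE : E.det = y * (y + r) := by
    simp [E, det_fromBlocks_zero₂₁]
  have hEVP : (E + V * P).det = (y - 2 * Fintype.card m) * (y + r - 2 * Fintype.card k)
        - Fintype.card m * Fintype.card k := by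
    have : E + V * P = fromBlocks (of fun _ _ => y - 2 * Fintype.card m)
        (of fun _ _ => - (Fintype.card k : ℝ)) (of fun _ _ => - (Fintype.card m : ℝ))
        (of fun _ _ => y + r - 2 * Fintype.card k) := by
      simp only [E, V, P, fromBlocks_multiply, fromBlocks_add]
      congr 1 <;> ext i j <;> simp [allOnes_mul_allOnes] <;> ring
    rw [this, ← det_reindex_self (finSumFinEquiv.symm.trans
      (Equiv.sumCongr (Equiv.ofUnique (Fin 1) Unit) (Equiv.ofUnique (Fin 1) Unit))).symm, det_fin_two]
    change (y - 2 * (Fintype.card m : ℝ)) * (y + r - 2 * (Fintype.card k : ℝ)) -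
      (-(Fintype.card k : ℝ)) * (-(Fintype.card m : ℝ)) = _
    ring
  have hsum : scalar (m ⊕ k) (y - 2) - fromBlocks ((2 : ℝ) • allOnes m m ℝ - (2 : ℝ) • 1)
      (allOnes m k ℝ) (allOnes k m ℝ) ((2 : ℝ) • allOnes k k ℝ - (2 : ℝ) • 1 - K) = A + P * V := by
    have h1 : scalar (m ⊕ k) (y - 2) = fromBlocks ((y - 2) • 1) 0 0 ((y - 2) • 1) := by
      rw [scalar_apply, ← smul_one_eq_diagonal, ← fromBlocks_one, fromBlocks_smul, smul_zero, smul_zero]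
    rw [h1]
    simp only [A, V, P, fromBlocks_multiply, fromBlocks_add, sub_eq_add_neg, fromBlocks_neg]
    congr 1 <;> simp [allOnes_mul_allOnes, add_smul]; abel
  rw [hsum, ← hE, ← hA, ← hEVP]
  exact det_add_mul_of_mul_eq_mul V hAP
    (by rw [hA]; exact (mul_ne_zero (pow_ne_zero _ hy) hdet).isUnit)
    (by rw [hE]; exact (mul_ne_zero hy hyr).isUnit)

end Matrix

theorem unitaryCayleyMatrix_mul_allOnes (n : ℕ) [NeZero n] :
    unitaryCayleyMatrix n ℝ * Matrix.allOnes (ZMod n) Unit ℝ =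
      (Nat.totient n : ℝ) • Matrix.allOnes (ZMod n) Unit ℝ := by
  classical
  ext i j
  rw [Matrix.mul_apply, ← Equiv.sum_comp (Equiv.subLeft i)]
  simp only [unitaryCayleyMatrix, Matrix.of_apply, Equiv.subLeft_apply, sub_sub_cancel,
    Matrix.allOnes_apply, mul_one, Matrix.smul_apply, smul_eq_mul]
  rw [sum_ite_isUnit (fun _ => (1 : ℝ))]
  simp [ZMod.card_units_eq_totient]

/-- The eigenvalues of the unitary Cayley graph of `ℤ/n`. -/
noncomputable def ramanujanValue (n d : ℕ) : ℝ :=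
  (ArithmeticFunction.moebius d : ℝ) * ((Nat.totient n : ℝ) / (Nat.totient d : ℝ))

theorem det_smul_one_add_unitaryCayleyMatrix (n : ℕ) [NeZero n] (y : ℝ) :
    (y • 1 + unitaryCayleyMatrix n ℝ).det =
      ∏ d ∈ n.divisors, (y + ramanujanValue n d) ^ Nat.totient d := by
  have h := congrArg (Polynomial.eval (-y)) (charpoly_unitaryCayleyMatrix n)
  rw [Matrix.eval_charpoly, Polynomial.eval_prod] at h
  have h1 : y • 1 + unitaryCayleyMatrix n ℝ =
      -(Matrix.scalar (ZMod n) (-y) - unitaryCayleyMatrix n ℝ) := by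
    rw [Matrix.scalar_apply, ← Matrix.smul_one_eq_diagonal, neg_smul]
    abel
  -- The sign (-1)^n is distributed over the factors through Σ φ(d) = n.
  rw [h1, Matrix.det_neg, h, ZMod.card, ← Nat.sum_totient n, ← Finset.prod_pow_eq_pow_sum,
    Nat.sum_totient, ← Finset.prod_mul_distrib]
  refine Finset.prod_congr rfl fun d _ => ?_
  rw [← ramanujanValue, Polynomial.eval_pow, ← mul_pow]
  simp [add_comm]

/-! ### Characteristic polynomial of the distance matrix -/

namespace DihedralGroup

/-- The distance matrix of the reduced generating graph of `D_n`, in block form. -/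
noncomputable def distanceBlocks (n : ℕ) :
    Matrix ((ZMod n)ˣ ⊕ ZMod n) ((ZMod n)ˣ ⊕ ZMod n) ℝ :=
  open Classical in
  Matrix.fromBlocks ((2 : ℝ) • Matrix.allOnes _ _ ℝ - (2 : ℝ) • 1) (Matrix.allOnes _ _ ℝ)
    (Matrix.allOnes _ _ ℝ) ((2 : ℝ) • Matrix.allOnes _ _ ℝ - (2 : ℝ) • 1 - unitaryCayleyMatrix n ℝ)

theorem distanceMatrix_eq_reindex {n : ℕ} (hn : 2 ≤ n) :
    distanceMatrix (reducedGeneratingGraph (DihedralGroup n)) =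
      Matrix.reindex (unitsSumEquiv n) (unitsSumEquiv n) (distanceBlocks n) := by
  rw [← Equiv.symm_apply_eq]
  -- Makes `0` a nonunit, so that K has zero diagonal.
  have : Fact (1 < n) := ⟨hn⟩
  ext (u | i) (v | j)
  · simp only [Matrix.reindex_symm, Matrix.reindex_apply, Equiv.symm_symm, Matrix.submatrix_apply,
      distanceMatrix, Matrix.of_apply, dist_unitsSumEquiv_inl_inl, distanceBlocks,
      Matrix.fromBlocks_apply₁₁, Matrix.sub_apply, Matrix.smul_apply, Matrix.one_apply]
    split_ifs <;> simp
  · simp [distanceMatrix, dist_unitsSumEquiv_inl_inr, distanceBlocks]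
  · simp [distanceMatrix, SimpleGraph.dist_comm, dist_unitsSumEquiv_inl_inr, distanceBlocks]
  · simp only [Matrix.reindex_symm, Matrix.reindex_apply, Equiv.symm_symm, Matrix.submatrix_apply,
      distanceMatrix, Matrix.of_apply, dist_unitsSumEquiv_inr_inr hn, distanceBlocks,
      Matrix.fromBlocks_apply₂₂, Matrix.sub_apply, Matrix.smul_apply, Matrix.one_apply,
      unitaryCayleyMatrix]
    by_cases h : i = j
    · simp [h]
    · by_cases h' : IsUnit (i - j) <;> simp [h, h']
      norm_num

open Classical in
theorem charpoly_distanceBlocks_mul (n : ℕ) [NeZero n] :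
    (distanceBlocks n).charpoly * ((X + C 2) * (X + C 2 + C (Nat.totient n : ℝ))) =
      (X + C 2) ^ Nat.totient n *
        (∏ d ∈ n.divisors, (X + C 2 + C (ramanujanValue n d)) ^ Nat.totient d) *
      ((X + C 2 - 2 * C (Nat.totient n : ℝ)) * (X + C 2 + C (Nat.totient n : ℝ) - 2 * C (n : ℝ))
        - C (Nat.totient n : ℝ) * C (n : ℝ)) := by
  -- The determinant formula needs `y`, `y + r` and det(y + K) nonzero. Multiplying by their product
  -- `p` makes the identity trivial at the excluded points.
  set p : ℝ[X] := (X + C 2) * (X + C 2 + C (Nat.totient n : ℝ)) *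
    ∏ d ∈ n.divisors, (X + C 2 + C (ramanujanValue n d)) ^ Nat.totient d with hp
  have hp0 : p ≠ 0 := by
    simp_rw [hp, add_assoc, ← C_add]
    exact mul_ne_zero (mul_ne_zero (X_add_C_ne_zero _) (X_add_C_ne_zero _))
      (Finset.prod_ne_zero_iff.2 fun d _ => pow_ne_zero _ (X_add_C_ne_zero _))
  apply mul_left_cancel₀ hp0
  apply Polynomial.funext
  intro x
  rw [eval_mul, eval_mul (p := p)]
  by_cases hx : eval x p = 0
  · rw [hx, zero_mul, zero_mul]
  congr 1
  simp only [hp, eval_mul, eval_add, eval_X, eval_C, eval_prod, eval_pow, mul_ne_zero_iff,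
    ne_eq] at hx
  obtain ⟨⟨h1, h2⟩, h3⟩ := by simpa only [not_or, mul_eq_zero] using hx
  rw [← det_smul_one_add_unitaryCayleyMatrix] at h3
  have key := Matrix.eval_charpoly_join (m := (ZMod n)ˣ) (unitaryCayleyMatrix n ℝ)
    (Nat.totient n) (x + 2) (unitaryCayleyMatrix_mul_allOnes n) h1 h2 h3
  rw [add_sub_cancel_right, det_smul_one_add_unitaryCayleyMatrix, ZMod.card_units_eq_totient,
    ZMod.card] at key
  simpa [Matrix.eval_charpoly, distanceBlocks, eval_prod] using key

end DihedralGroup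

theorem Multiset.prod_map_finset_sum {ι α M : Type*} [CommMonoid M] (s : Finset ι) (t : ι → Multiset α)
    (f : α → M) : (Multiset.map f (∑ i ∈ s, t i)).prod = ∏ i ∈ s, (Multiset.map f (t i)).prod := by
  classical
  induction s using Finset.induction_on with
  | empty => simp
  | insert a s ha ih => rw [Finset.sum_insert ha, Finset.prod_insert ha, Multiset.map_add,
      Multiset.prod_add, ih]

open UniqueFactorizationMonoid in
/-- Only the squarefree divisors contribute nonzero Ramanujan sums. -/
theorem prod_divisors_erase_ramanujanValue {n : ℕ} (hn : n ≠ 0) :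
    ∏ d ∈ n.divisors.erase 1, (X + C 2 + C (ramanujanValue n d)) ^ Nat.totient d =
      (∏ d ∈ (radical n).divisors.erase 1, (X + C 2 + C (ramanujanValue n d)) ^ Nat.totient d) *
        (X + C 2) ^ (n - radical n) := by
  have hsub : (radical n).divisors ⊆ n.divisors := Nat.divisors_subset_of_dvd hn radical_dvd_self
  have hsd : n.divisors.erase 1 \ (radical n).divisors.erase 1
      = n.divisors \ (radical n).divisors := by
    ext d
    have : 1 ∈ (radical n).divisors := Nat.one_mem_divisors.2 radical_ne_zero
    simp only [Finset.mem_sdiff, Finset.mem_erase]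
    grind
  have hexp : n - radical n = ∑ d ∈ n.divisors \ (radical n).divisors, Nat.totient d := by
    have := Finset.sum_sdiff (f := Nat.totient) hsub
    rw [Nat.sum_totient, Nat.sum_totient] at this
    omega
  rw [← Finset.prod_sdiff (Finset.erase_subset_erase 1 hsub), hsd, mul_comm, hexp,
    ← Finset.prod_pow_eq_pow_sum]
  congr 1
  refine Finset.prod_congr rfl fun d hd => ?_
  rw [Finset.mem_sdiff, Nat.mem_divisors, Nat.mem_divisors] at hd
  have hsq : ¬ Squarefree d := fun h => hd.2
    ⟨(dvd_radical_iff h.isRadical hn).2 hd.1.1, radical_ne_zero⟩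
  simp [ramanujanValue, ArithmeticFunction.moebius_eq_zero_of_not_squarefree hsq]

namespace DihedralGroup
open UniqueFactorizationMonoid

open Classical in
theorem charpoly_distanceBlocks (n : ℕ) [NeZero n] :
    (distanceBlocks n).charpoly =
      (X + C 2) ^ (Nat.totient n + n - radical n - 1) *
        (∏ d ∈ (radical n).divisors.erase 1,
          (X + C 2 + C (ramanujanValue n d)) ^ Nat.totient d) *
      ((X + C 2 - 2 * C (Nat.totient n : ℝ)) * (X + C 2 + C (Nat.totient n : ℝ) - 2 * C (n : ℝ))
        - C (Nat.totient n : ℝ) * C (n : ℝ)) := by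
  have hn : n ≠ 0 := NeZero.ne n
  have h := charpoly_distanceBlocks_mul n
  rw [← Finset.mul_prod_erase _ _ (Nat.one_mem_divisors.2 hn),
    prod_divisors_erase_ramanujanValue hn] at h
  have h1 : ramanujanValue n 1 = Nat.totient n := by simp [ramanujanValue]
  rw [h1, Nat.totient_one, pow_one] at h
  have h0 : (X + C 2) * (X + C 2 + C (Nat.totient n : ℝ)) ≠ 0 := by
    simp_rw [add_assoc, ← C_add]
    exact mul_ne_zero (X_add_C_ne_zero _) (X_add_C_ne_zero _)
  apply mul_right_cancel₀ h0
  rw [h]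
  have hpos : 0 < Nat.totient n := Nat.totient_pos.2 (NeZero.pos n)
  have hle : radical n ≤ n := Nat.radical_le_self_iff.2 hn
  -- The `d = 1` factor cancels X + 2 + φ(n); cancelling the other X + 2 costs one power. Since φ(n)
  -- > 0 and rad n ≤ n, no subtraction truncates.
  have hexp : (X + C 2 : ℝ[X]) ^ Nat.totient n * (X + C 2) ^ (n - radical n) =
      (X + C 2) ^ (Nat.totient n + n - radical n - 1) * (X + C 2) := by
    rw [← pow_add, ← pow_succ]
    congr 1
    omega
  generalize (X + C 2 - 2 * C (Nat.totient n : ℝ)) * (X + C 2 + C (Nat.totient n : ℝ) -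
    2 * C (n : ℝ)) - C (Nat.totient n : ℝ) * C (n : ℝ) = q
  generalize ∏ d ∈ (radical n).divisors.erase 1, (X + C 2 + C (ramanujanValue n d)) ^ Nat.totient d
    = Q
  linear_combination (X + C 2 + C (Nat.totient n : ℝ)) * Q * q * hexp

end DihedralGroup

/-! ### Reading off the spectrum -/

theorem distanceSpectrum_eq_roots_charpoly {V W : Type*} [Finite V] [Fintype W] [DecidableEq W]
    {G : SimpleGraph V} (e : W ≃ V) (N : Matrix W W ℝ)
    (h : distanceMatrix G = Matrix.reindex e e N) : distanceSpectrum G = N.charpoly.roots := by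
  classical
  let := Fintype.ofFinite V
  rw [← Matrix.charpoly_reindex e, ← h, distanceSpectrum]

/-- Factorization of the quadratic factor belonging to the quotient matrix. -/
theorem quotient_quadratic_eq (f n : ℝ) :
    (X + C 2 - 2 * C f) * (X + C 2 + C f - 2 * C n) - C f * C n =
      (X - C ((n - 2 + f / 2) + √(n ^ 2 + (3 * f / 2) ^ 2 - 2 * n * f))) *
        (X - C ((n - 2 + f / 2) - √(n ^ 2 + (3 * f / 2) ^ 2 - 2 * n * f))) := by
  -- The radicand is (n - f)² + 5f²/4.
  have hD : 0 ≤ n ^ 2 + (3 * f / 2) ^ 2 - 2 * n * f := by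
    nlinarith [sq_nonneg (n - f), sq_nonneg f]
  have hs := Real.sq_sqrt hD
  apply Polynomial.funext
  intro x
  simp only [eval_sub, eval_mul, eval_add, eval_X, eval_C, eval_ofNat]
  linear_combination hs

theorem mainTheorem5 (n : ℕ) [NeZero n] (hn : 2 ≤ n) :
    (reducedGeneratingGraph (DihedralGroup n)).Connected ∧
    distanceSpectrum (reducedGeneratingGraph (DihedralGroup n)) =
      Multiset.replicate
          (Nat.totient n + n - UniqueFactorizationMonoid.radical n - 1) (-2 : ℝ) +
        (∑ d ∈ (UniqueFactorizationMonoid.radical n).divisors.erase 1,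
          Multiset.replicate (Nat.totient d)
            (-2 - (ArithmeticFunction.moebius d : ℝ) *
              ((Nat.totient n : ℝ) / (Nat.totient d : ℝ)))) +
        {((n : ℝ) - 2 + (Nat.totient n : ℝ) / 2) +
            √((n : ℝ) ^ 2 + (3 * (Nat.totient n : ℝ) / 2) ^ 2 - 2 * n * Nat.totient n),
          ((n : ℝ) - 2 + (Nat.totient n : ℝ) / 2) -
            √((n : ℝ) ^ 2 + (3 * (Nat.totient n : ℝ) / 2) ^ 2 - 2 * n * Nat.totient n)} := by
  refine ⟨DihedralGroup.connected_reducedGeneratingGraph n, ?_⟩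
  classical
  -- The claimed multiset is rewritten as the roots of its product of linear factors, leaving two
  -- polynomials to compare.
  rw [distanceSpectrum_eq_roots_charpoly _ _ (DihedralGroup.distanceMatrix_eq_reindex hn),
    DihedralGroup.charpoly_distanceBlocks, quotient_quadratic_eq,
    ← roots_multiset_prod_X_sub_C (_ + _ + _), Multiset.map_add, Multiset.map_add,
    Multiset.prod_add, Multiset.prod_add, Multiset.prod_map_finset_sum]
  have h (t : ℝ) : X - C (-2 - t) = X + C 2 + C t := by
    rw [C_sub, C_neg]
    ring
  simp only [Multiset.map_replicate, Multiset.prod_replicate, Multiset.insert_eq_cons,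
    Multiset.map_cons, Multiset.map_singleton, Multiset.prod_cons, Multiset.prod_singleton, h,
    ramanujanValue]
  rw [C_neg, sub_neg_eq_add]
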